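/- Let $\mathbb{A}$ be a countably infinite set of atoms. A (nondeterministic) nominal automaton $\mathcal{A}=(\Sigma,Q,I,F,\delta)$ consists of orbit-finite nominal sets $\Sigma$ (alphabet) and $Q$ (states), i.e. sets with an action of $\mathrm{Perm}(\mathbb{A})$ that has finitely many orbits and for which every element is finitely supported, and of equivariant subsets $I,F\subseteq Q$ and $\delta\subseteq Q\times\Sigma\times Q$. It is residual if for every $q\in Q$ the language $\mathcal{L}(q)$ accepted from $q$ equals $w^{-1}\mathcal{L}(\mathcal{A})=\{u\mid wu\in\mathcal{L}(\mathcal{A})\}$ for some $w\in\Sigma^*$. Nominal automata are represented by finite data as follows. An orbit-finite nominal set is represented, up to equivariant bijection, by a finite list of orbit representatives of an equivariant partial equivalence relation on finite tuples of atoms tagged with natural numbers; the represented set is the set of equivalence classes. The sets $I$, $F$, $\delta$ are represented by finite lists of representatives of their orbits (as tagged tuples, and triples of tagged tuples; tuples that do not belong to any equivalence class are ignored). In representatives, natural numbers stand for distinct atoms. **Proposition 5.1.** Every nominal automaton has such a finite representation, and universality is decidable for residual nominal automata: there is a computable function $D$ from representations to $\{\text{yes},\text{no}\}$ such that, for every nominal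 automaton $\mathcal{A}$ and every representation $c$ of $\mathcal{A}$, 1. $D(c)=\text{yes}$ if and only if $I\neq\emptyset$, every state is final ($Q=F$), and for all $q\in Q$ and $a\in\Sigma$ there is $q'\in Q$ with $(q,a,q')\in\delta$; 2. if $\mathcal{A}$ is residual, then $D(c)=\text{yes}$ if and only if $\mathcal{L}(\mathcal{A})=\Sigma^*$. -/

import Mathlib

universe u v w

/-- `X` with the given action of the permutations of the atoms is a nominal set: every element
has a finite support. -/
def IsNominal (𝔸 : Type u) (X : Type v) [MulAction (Equiv.Perm 𝔸) X] : Prop :=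
  ∀ x : X, ∃ S : Finset 𝔸, MulAction.Supports (Equiv.Perm 𝔸) (S : Set 𝔸) x

/-- `X` is a finite union of orbits. -/
def IsOrbitFinite (𝔸 : Type u) (X : Type v) [MulAction (Equiv.Perm 𝔸) X] : Prop :=
  Finite (MulAction.orbitRel.Quotient (Equiv.Perm 𝔸) X)

/-- A nondeterministic nominal automaton over the atoms `𝔸`, with alphabet `α` and state set `σ`:
both are orbit-finite nominal sets, and the initial states, the final states and the transition
relation `{(q, a, q') | q' ∈ step q a}` are equivariant. -/
structure NominalAutomaton (𝔸 : Type u) (α : Type v) (σ : Type w)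
    [MulAction (Equiv.Perm 𝔸) α] [MulAction (Equiv.Perm 𝔸) σ] extends NFA α σ where
  nominal_alphabet : IsNominal 𝔸 α
  orbitFinite_alphabet : IsOrbitFinite 𝔸 α
  nominal_states : IsNominal 𝔸 σ
  orbitFinite_states : IsOrbitFinite 𝔸 σ
  start_equivariant : ∀ (π : Equiv.Perm 𝔸) (q : σ), q ∈ start → π • q ∈ start
  accept_equivariant : ∀ (π : Equiv.Perm 𝔸) (q : σ), q ∈ accept → π • q ∈ accept
  step_equivariant : ∀ (π : Equiv.Perm 𝔸) (q : σ) (a : α) (q' : σ),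
    q' ∈ step q a → π • q' ∈ step (π • q) (π • a)

namespace NominalAutomaton

variable {𝔸 : Type u} {α : Type v} {σ : Type w}
  [MulAction (Equiv.Perm 𝔸) α] [MulAction (Equiv.Perm 𝔸) σ]

/-- Every state accepts a derivative of the language of the automaton. -/
def IsResidual (A : NominalAutomaton 𝔸 α σ) : Prop :=
  ∀ q : σ, ∃ w : List α, A.acceptsFrom {q} = A.accepts.leftQuotient w

/-- The automaton accepts every word. -/
def IsUniversal (A : NominalAutomaton 𝔸 α σ) : Prop :=
  ∀ w : List α, w ∈ A.accepts

end NominalAutomaton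

/-- Elements of the disjoint union, over the tags `i : ℕ`, of the sets of finite tuples of atoms. -/
abbrev TaggedTuple (𝔸 : Type u) : Type u := ℕ × List 𝔸

/-- Apply a map of atoms to all entries of a tagged tuple. -/
def TaggedTuple.map {𝔸 : Type u} {𝔹 : Type v} (f : 𝔸 → 𝔹) (t : TaggedTuple 𝔸) : TaggedTuple 𝔹 :=
  (t.1, t.2.map f)

/-- Finite data for an orbit-finite nominal set: finitely many pairs of tagged tuples, which are
representatives of the orbits of an equivariant partial equivalence relation on tagged tuples of
atoms. In representatives, natural numbers stand for pairwise distinct atoms. -/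
abbrev SetCode : Type := List (TaggedTuple ℕ × TaggedTuple ℕ)

/-- The equivariant relation on tagged tuples of atoms that is generated by the representatives. -/
def SetCode.Rel (s : SetCode) (𝔸 : Type u) (x y : TaggedTuple 𝔸) : Prop :=
  ∃ p ∈ s, ∃ e : ℕ ≃ 𝔸, p.1.map e = x ∧ p.2.map e = y

/-- `X` is, as a set with an action, the quotient of the tagged tuples in the domain of the
relation of `s` by that relation. The quotient map is the partial map `el`: it is surjective and
equivariant, and its kernel (hence also its domain) is given by the relation of `s`. -/
structure SetCode.Presentation (s : SetCode) (𝔸 : Type u) (X : Type v)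
    [MulAction (Equiv.Perm 𝔸) X] where
  el : TaggedTuple 𝔸 → Option X
  surjective : ∀ a : X, ∃ x, el x = some a
  equivariant : ∀ (π : Equiv.Perm 𝔸) (x : TaggedTuple 𝔸), el (x.map π) = (el x).map (π • ·)
  rel_iff : ∀ x y, s.Rel 𝔸 x y ↔ ∃ a : X, el x = some a ∧ el y = some a

/-- Finite data for a nominal automaton: codes of the alphabet and of the set of states, and
finitely many representatives of the orbits of initial states, of final states and of
transitions `(q, a, q')`. -/
structure AutomatonCode where
  alphabet : SetCode
  states : SetCode
  start : List (TaggedTuple ℕ)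
  accept : List (TaggedTuple ℕ)
  trans : List (TaggedTuple ℕ × TaggedTuple ℕ × TaggedTuple ℕ)

namespace AutomatonCode

/-- An automaton code is the tuple of its components. -/
def equivProd : AutomatonCode ≃ SetCode × SetCode × List (TaggedTuple ℕ) × List (TaggedTuple ℕ) ×
    List (TaggedTuple ℕ × TaggedTuple ℕ × TaggedTuple ℕ) where
  toFun c := (c.alphabet, c.states, c.start, c.accept, c.trans)
  invFun p := ⟨p.1, p.2.1, p.2.2.1, p.2.2.2.1, p.2.2.2.2⟩
  left_inv _ := rfl
  right_inv _ := rfl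

instance : Primcodable AutomatonCode := Primcodable.ofEquiv _ equivProd

/-- The code `c` is a finite representation of the nominal automaton `A`. -/
def Represents (c : AutomatonCode) {𝔸 : Type u} {α : Type v} {σ : Type w}
    [MulAction (Equiv.Perm 𝔸) α] [MulAction (Equiv.Perm 𝔸) σ]
    (A : NominalAutomaton 𝔸 α σ) : Prop :=
  ∃ (l : c.alphabet.Presentation 𝔸 α) (s : c.states.Presentation 𝔸 σ),
    (∀ q, q ∈ A.start ↔ ∃ t ∈ c.start, ∃ e : ℕ ≃ 𝔸, s.el (t.map e) = some q) ∧
    (∀ q, q ∈ A.accept ↔ ∃ t ∈ c.accept, ∃ e : ℕ ≃ 𝔸, s.el (t.map e) = some q) ∧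
    (∀ q a q', q' ∈ A.step q a ↔ ∃ t ∈ c.trans, ∃ e : ℕ ≃ 𝔸,
      s.el (t.1.map e) = some q ∧ l.el (t.2.1.map e) = some a ∧ s.el (t.2.2.map e) = some q')

end AutomatonCode

/-! ### Permutations extending finite partial injections -/

/-! In a residual automaton the language of each state is a derivative of the whole language, so
universality makes every state universal. Testing the empty word and one-letter words then gives the
local criterion: an initial state exists, all states are final, no transition is missing.
Conversely, under this criterion no run gets stuck or ends badly (`isUniversal_iff`). The criterion
is equivariant, so it can be tested on orbits. An enumeration of the atoms transports it to `ℕ`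
(`rel_map_iff`), where two tuples lie in one orbit iff they have the same pattern of equalities
(`sameType_iff`). For transitions, permutations fixing the relevant atoms push all other entries
below a computable bound (`List.exists_perm_lt`), so only bounded quantifiers remain and the test is
primitive recursive (`allStep_iff`). Representations exist because a point of an orbit is determined
by the image of a listed support of a chosen orbit representative; with bounded tags and lengths,
finitely many tuples of small numbers meet all orbits. -/

theorem Finset.exists_perm_eqOn {α : Type*} (S : Finset α) (f : α → α)
    (hf : Set.InjOn f S) : ∃ π : Equiv.Perm α, ∀ a ∈ S, π a = f a := by
  obtain ⟨π, hπ⟩ := Equiv.Perm.exists_extending_pair (Subtype.val : S → α) (fun a => f a)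
    Subtype.val_injective fun a b h => Subtype.ext (hf a.2 b.2 h)
  exact ⟨π, fun a ha => hπ ⟨a, ha⟩⟩

/-- A finite list of numbers can be moved below `K + n`, where `n` is its length, by a permutation
that fixes all numbers below `K`. -/
theorem List.exists_perm_lt (K : ℕ) (l : List ℕ) :
    ∃ π : Equiv.Perm ℕ, (∀ a < K, π a = a) ∧ ∀ a ∈ l, π a < K + l.length := by
  -- Entries from `K` on are renumbered by their first position in the list; this is injective on
  -- the numbers below `K` and the entries of `l`.
  let f : ℕ → ℕ := fun a => if a < K then a else K + l.idxOf a
  obtain ⟨π, hπ⟩ := Finset.exists_perm_eqOn (Finset.range K ∪ l.toFinset) f (by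
    intro a ha b hb hab
    simp only [Finset.coe_union, Finset.coe_range, Set.mem_union, Set.mem_Iio, Finset.mem_coe,
      List.mem_toFinset] at ha hb
    simp only [f] at hab
    split_ifs at hab with h1 h2 h2
    · exact hab
    · omega
    · omega
    · exact (List.idxOf_inj (ha.resolve_left h1)).1 (by omega))
  refine ⟨π, fun a ha => ?_, fun a ha => ?_⟩
  · rw [hπ a (by simp [ha])]
    simp [f, ha]
  · rw [hπ a (by simp [ha])]
    have := List.idxOf_lt_length_of_mem ha
    simp only [f]
    split_ifs <;> omega

/-- The lists have the same length and the same equalities between entries. -/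
def List.SameType (l l' : List ℕ) : Prop :=
  l.length = l'.length ∧
    ∀ i < l.length, ∀ j < l.length, (l[i]? = l[j]? ↔ l'[i]? = l'[j]?)

/-- Equal patterns make `l[i] ↦ l'[i]` a well-defined finite partial injection, which extends to a
permutation. The default `0` of `getD` is never reached, as all indices are in range. -/
theorem List.sameType_iff {l l' : List ℕ} :
    l.SameType l' ↔ ∃ π : Equiv.Perm ℕ, l.map π = l' := by
  constructor
  · rintro ⟨hlen, h⟩
    have h' : ∀ i (hi : i < l.length) j (hj : j < l.length),
        l[i] = l[j] ↔ l'.getD i 0 = l'.getD j 0 := by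
      intro i hi j hj
      have := h i hi j hj
      have hi' : i < l'.length := hlen ▸ hi
      have hj' : j < l'.length := hlen ▸ hj
      simpa [hi, hj, hi', hj'] using this
    obtain ⟨π, hπ⟩ := Finset.exists_perm_eqOn l.toFinset (fun a => l'.getD (l.idxOf a) 0) (by
      intro a ha b hb hab
      simp only [Finset.mem_coe, List.mem_toFinset] at ha hb
      have := (h' _ (List.idxOf_lt_length_of_mem ha) _ (List.idxOf_lt_length_of_mem hb)).2 hab
      simpa using this)
    refine ⟨π, List.ext_getElem (by simpa using hlen) fun i hi hi' => ?_⟩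
    simp only [List.length_map] at hi
    have hm : l[i] ∈ l := List.getElem_mem hi
    rw [List.getElem_map, hπ _ (by simp [hm])]
    have := (h' _ (List.idxOf_lt_length_of_mem hm) i hi).1 (List.getElem_idxOf _)
    rw [this, List.getD_eq_getElem _ _ hi']
  · rintro ⟨π, rfl⟩
    refine ⟨by simp, fun i _ j _ => ?_⟩
    simp only [List.getElem?_map]
    exact (Option.map_injective π.injective).eq_iff.symm

/-! ### Tagged tuples of natural numbers -/

namespace TaggedTuple

@[simp]
theorem map_snd {𝔸 : Type u} {𝔹 : Type v} (f : 𝔸 → 𝔹) (t : TaggedTuple 𝔸) :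
    (t.map f).2 = t.2.map f := rfl

theorem map_map {𝔸 : Type u} {𝔹 : Type v} {𝕏 : Type w} (g : 𝔹 → 𝕏) (f : 𝔸 → 𝔹)
    (t : TaggedTuple 𝔸) : (t.map f).map g = t.map (g ∘ f) := by
  simp [TaggedTuple.map]

theorem map_id {𝔸 : Type u} (t : TaggedTuple 𝔸) : t.map id = t := by
  simp [TaggedTuple.map]

theorem map_congr {𝔸 : Type u} {𝔹 : Type v} {f g : 𝔸 → 𝔹} {t : TaggedTuple 𝔸}
    (h : ∀ a ∈ t.2, f a = g a) : t.map f = t.map g :=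
  Prod.ext rfl (List.map_congr_left h)

theorem map_eq_self {𝔸 : Type u} {f : 𝔸 → 𝔸} {t : TaggedTuple 𝔸}
    (h : ∀ a ∈ t.2, f a = a) : t.map f = t :=
  (map_congr h).trans t.map_id

/-- Some permutation maps `x` to `x'` and `y` to `y'`. -/
def SameOrbit (x x' y y' : TaggedTuple ℕ) : Prop :=
  (x.1 = x'.1 ∧ y.1 = y'.1) ∧ x.2.length = x'.2.length ∧ (x.2 ++ y.2).SameType (x'.2 ++ y'.2)

/-- Concatenation turns a simultaneous permutation of two tuples into one of a single list; equality
of the first lengths lets the concatenation be split again. -/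
theorem sameOrbit_iff {x x' y y' : TaggedTuple ℕ} :
    SameOrbit x x' y y' ↔ ∃ π : Equiv.Perm ℕ, x.map π = x' ∧ y.map π = y' := by
  rw [SameOrbit, List.sameType_iff]
  constructor
  · rintro ⟨⟨hx, hy⟩, hlen, π, hπ⟩
    rw [List.map_append] at hπ
    obtain ⟨h1, h2⟩ := List.append_inj hπ (by simpa using hlen)
    exact ⟨π, Prod.ext hx h1, Prod.ext hy h2⟩
  · rintro ⟨π, rfl, rfl⟩
    exact ⟨⟨rfl, rfl⟩, by simp, π, by simp⟩

end TaggedTuple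

theorem SetCode.rel_iff_sameOrbit {s : SetCode} {x y : TaggedTuple ℕ} :
    s.Rel ℕ x y ↔ ∃ p ∈ s, TaggedTuple.SameOrbit p.1 x p.2 y := by
  simp only [SetCode.Rel, TaggedTuple.sameOrbit_iff, Equiv.Perm]

/-! ### Bounded lists -/

/-- The lists of length at most `n` with entries below `K`. -/
def boundedListsAux (K n : ℕ) : List (List ℕ) :=
  n.rec [[]] fun _ ls => [] :: ls.flatMap fun l => (List.range K).map fun a => a :: l

/-- The lists of length at most `K` with entries below `K`. -/
def boundedLists (K : ℕ) : List (List ℕ) := boundedListsAux K K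

theorem mem_boundedListsAux {K n : ℕ} {l : List ℕ} :
    l ∈ boundedListsAux K n ↔ l.length ≤ n ∧ ∀ a ∈ l, a < K := by
  induction n generalizing l with
  | zero => cases l <;> simp [boundedListsAux]
  | succ n ih =>
    change l ∈ [] :: (boundedListsAux K n).flatMap _ ↔ _
    cases l with
    | nil => simp
    | cons b l => simp [ih]; grind

theorem mem_boundedLists {K : ℕ} {l : List ℕ} :
    l ∈ boundedLists K ↔ l.length ≤ K ∧ ∀ a ∈ l, a < K := mem_boundedListsAux

/-- The code of a tuple serves as a primitive recursive bound on its entries and its length in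
`AllStep`. -/
theorem List.le_encode_of_mem {l : List ℕ} {a : ℕ} (h : a ∈ l) : a ≤ Encodable.encode l := by
  induction l with
  | nil => simp at h
  | cons b l ih =>
    rw [Encodable.encode_list_cons]
    rcases List.mem_cons.1 h with rfl | h
    · exact (Nat.left_le_pair _ _).trans (Nat.le_succ _)
    · exact (ih h).trans ((Nat.right_le_pair _ _).trans (Nat.le_succ _))

theorem TaggedTuple.le_encode_of_mem {t : TaggedTuple ℕ} {a : ℕ} (h : a ∈ t.2) :
    a ≤ Encodable.encode t :=
  (List.le_encode_of_mem h).trans (Nat.right_le_pair _ _)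

theorem TaggedTuple.length_le_encode (t : TaggedTuple ℕ) : t.2.length ≤ Encodable.encode t :=
  (Encodable.length_le_encode t.2).trans (Nat.right_le_pair _ _)

/-! ### The decision procedure -/

namespace PrimrecPred

variable {α : Type u} {β : Type v} [Primcodable α] [Primcodable β]

theorem exists_mem {f : β → List α} {R : β → α → Prop} (hf : Primrec f)
    (hR : PrimrecPred fun z : β × α => R z.1 z.2) : PrimrecPred fun b => ∃ a ∈ f b, R b a :=
  have h : PrimrecRel fun (a : α) (b : β) => R b a := hR.comp (Primrec.snd.pair Primrec.fst)
  h.exists_mem_list.comp hf Primrec.id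

theorem forall_mem {f : β → List α} {R : β → α → Prop} (hf : Primrec f)
    (hR : PrimrecPred fun z : β × α => R z.1 z.2) : PrimrecPred fun b => ∀ a ∈ f b, R b a :=
  have h : PrimrecRel fun (a : α) (b : β) => R b a := hR.comp (Primrec.snd.pair Primrec.fst)
  h.forall_mem_list.comp hf Primrec.id

theorem imp {p q : α → Prop} (hp : PrimrecPred p) (hq : PrimrecPred q) :
    PrimrecPred fun a => p a → q a :=
  (hp.not.or hq).of_eq fun _ => imp_iff_not_or.symm

theorem iff {p q : α → Prop} (hp : PrimrecPred p) (hq : PrimrecPred q) :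
    PrimrecPred fun a => (p a ↔ q a) :=
  ((hp.imp hq).and (hq.imp hp)).of_eq fun _ => iff_iff_implies_and_implies.symm

end PrimrecPred

open Primrec in
theorem List.primrecRel_sameType : PrimrecRel List.SameType := by
  have h : PrimrecPred fun z : (List ℕ × List ℕ) => z.1.length = z.2.length ∧
      ∀ i ∈ List.range z.1.length, ∀ j ∈ List.range z.1.length,
        (z.1[i]? = z.1[j]? ↔ z.2[i]? = z.2[j]?) := by
    refine (Primrec.eq.comp (list_length.comp fst) (list_length.comp snd)).and
      (PrimrecPred.forall_mem (list_range.comp (list_length.comp fst))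
        (PrimrecPred.forall_mem (list_range.comp (list_length.comp (fst.comp fst)))
          (PrimrecPred.iff (Primrec.eq.comp ?_ ?_) (Primrec.eq.comp ?_ ?_))))
    · exact list_getElem?.comp (fst.comp (fst.comp fst)) (snd.comp fst)
    · exact list_getElem?.comp (fst.comp (fst.comp fst)) snd
    · exact list_getElem?.comp (snd.comp (fst.comp fst)) (snd.comp fst)
    · exact list_getElem?.comp (snd.comp (fst.comp fst)) snd
  exact h.of_eq fun z => by simp [List.SameType]

open Primrec in
theorem TaggedTuple.primrecPred_sameOrbit {γ : Type u} [Primcodable γ]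
    {f f' g g' : γ → TaggedTuple ℕ} (hf : Primrec f) (hf' : Primrec f') (hg : Primrec g)
    (hg' : Primrec g') : PrimrecPred fun c => SameOrbit (f c) (f' c) (g c) (g' c) :=
  ((Primrec.eq.comp (fst.comp hf) (fst.comp hf')).and
    (Primrec.eq.comp (fst.comp hg) (fst.comp hg'))).and
  ((Primrec.eq.comp (list_length.comp (snd.comp hf)) (list_length.comp (snd.comp hf'))).and
    (List.primrecRel_sameType.comp (list_append.comp (snd.comp hf) (snd.comp hg))
      (list_append.comp (snd.comp hf') (snd.comp hg'))))

open Primrec in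
-- The search over permutations is replaced by a comparison of equality patterns with each of the
-- finitely many representatives.
theorem SetCode.primrecPred_rel {γ : Type u} [Primcodable γ] {s : γ → SetCode}
    {f g : γ → TaggedTuple ℕ} (hs : Primrec s) (hf : Primrec f) (hg : Primrec g) :
    PrimrecPred fun c => (s c).Rel ℕ (f c) (g c) := by
  have h : PrimrecPred fun c => ∃ p ∈ s c, TaggedTuple.SameOrbit p.1 (f c) p.2 (g c) :=
    PrimrecPred.exists_mem hs (TaggedTuple.primrecPred_sameOrbit (fst.comp snd) (hf.comp fst)
      (snd.comp snd) (hg.comp fst))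
  exact h.of_eq fun c => SetCode.rel_iff_sameOrbit.symm

open Primrec in
theorem primrec_boundedLists : Primrec boundedLists := by
  refine Primrec.nat_rec' (β := List (List ℕ)) (f := fun K => K) (g := fun _ => [[]])
    (h := fun K z => [] :: z.2.flatMap fun l => (List.range K).map fun a => a :: l)
    Primrec.id (Primrec.const _) ?_
  refine list_cons.comp (Primrec.const _) (list_flatMap (snd.comp snd) ?_)
  exact list_map (list_range.comp (fst.comp fst)) (list_cons.comp snd (snd.comp fst))

namespace AutomatonCode

theorem primrec_equivProd : Primrec equivProd := Primrec.of_equiv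

theorem primrec_alphabet : Primrec alphabet := Primrec.fst.comp primrec_equivProd

theorem primrec_states : Primrec states :=
  Primrec.fst.comp (Primrec.snd.comp primrec_equivProd)

theorem primrec_start : Primrec start :=
  Primrec.fst.comp (Primrec.snd.comp (Primrec.snd.comp primrec_equivProd))

theorem primrec_accept : Primrec accept :=
  Primrec.fst.comp (Primrec.snd.comp (Primrec.snd.comp (Primrec.snd.comp primrec_equivProd)))

theorem primrec_trans : Primrec trans :=
  Primrec.snd.comp (Primrec.snd.comp (Primrec.snd.comp (Primrec.snd.comp primrec_equivProd)))

/-- Some representative of an orbit of initial states is in the domain of the state set. -/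
def HasStart (c : AutomatonCode) : Prop := ∃ t ∈ c.start, c.states.Rel ℕ t t

/-- Every orbit of states is one of the orbits of final states. -/
def AllAccept (c : AutomatonCode) : Prop :=
  ∀ p ∈ c.states, ∃ t ∈ c.accept, ∃ r ∈ c.states,
    TaggedTuple.SameOrbit r.1 t r.1 t ∧ TaggedTuple.SameOrbit r.2 p.1 r.2 p.1

/-- Every orbit of pairs of a state and a letter has a transition. It is enough to consider the
pairs whose state is a representative and whose letter has entries below some bound, and then the
members of the orbits of transitions with entries below some larger bound. -/
def AllStep (c : AutomatonCode) : Prop :=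
  ∀ p ∈ c.states, ∀ p' ∈ c.alphabet,
    ∀ l ∈ boundedLists (Encodable.encode p.1 + Encodable.encode p'.1 + 1),
      TaggedTuple.SameOrbit p'.1 (p'.1.1, l) p'.1 (p'.1.1, l) →
      ∃ t ∈ c.trans,
        ∃ l₁ ∈ boundedLists (Encodable.encode p.1 + Encodable.encode p'.1 + 1 +
          (Encodable.encode t.1 + Encodable.encode t.2.1)),
        ∃ l₂ ∈ boundedLists (Encodable.encode p.1 + Encodable.encode p'.1 + 1 +
          (Encodable.encode t.1 + Encodable.encode t.2.1)),
          TaggedTuple.SameOrbit t.1 (t.1.1, l₁) t.2.1 (t.2.1.1, l₂) ∧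
          c.states.Rel ℕ (t.1.1, l₁) p.1 ∧ c.alphabet.Rel ℕ (t.2.1.1, l₂) (p'.1.1, l) ∧
          c.states.Rel ℕ t.2.2 t.2.2

open Primrec in
theorem primrecPred_hasStart : PrimrecPred HasStart :=
  PrimrecPred.exists_mem primrec_start
    (SetCode.primrecPred_rel (primrec_states.comp fst) snd snd)

open Primrec in
theorem primrecPred_allAccept : PrimrecPred AllAccept := by
  refine PrimrecPred.forall_mem primrec_states
    (PrimrecPred.exists_mem (primrec_accept.comp fst)
      (PrimrecPred.exists_mem (primrec_states.comp (fst.comp fst)) (PrimrecPred.and ?_ ?_)))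
  · exact TaggedTuple.primrecPred_sameOrbit (fst.comp snd) (snd.comp fst) (fst.comp snd)
      (snd.comp fst)
  · have h : Primrec fun z : ((AutomatonCode × (TaggedTuple ℕ × TaggedTuple ℕ)) × TaggedTuple ℕ) ×
        (TaggedTuple ℕ × TaggedTuple ℕ) => z.1.1.2.1 := fst.comp (snd.comp (fst.comp fst))
    exact TaggedTuple.primrecPred_sameOrbit (snd.comp snd) h (snd.comp snd) h

open Primrec in
theorem primrecPred_allStep : PrimrecPred AllStep := by
  have key : PrimrecPred fun z : ((((((AutomatonCode × (TaggedTuple ℕ × TaggedTuple ℕ)) ×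
      (TaggedTuple ℕ × TaggedTuple ℕ)) × List ℕ) ×
      (TaggedTuple ℕ × TaggedTuple ℕ × TaggedTuple ℕ)) × List ℕ) × List ℕ) =>
      TaggedTuple.SameOrbit z.1.1.2.1 (z.1.1.2.1.1, z.1.2) z.1.1.2.2.1 (z.1.1.2.2.1.1, z.2) ∧
      z.1.1.1.1.1.1.states.Rel ℕ (z.1.1.2.1.1, z.1.2) z.1.1.1.1.1.2.1 ∧
      z.1.1.1.1.1.1.alphabet.Rel ℕ (z.1.1.2.2.1.1, z.2) (z.1.1.1.1.2.1.1, z.1.1.1.2) ∧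
      z.1.1.1.1.1.1.states.Rel ℕ z.1.1.2.2.2 z.1.1.2.2.2 := by
    let γ := ((((((AutomatonCode × (TaggedTuple ℕ × TaggedTuple ℕ)) ×
      (TaggedTuple ℕ × TaggedTuple ℕ)) × List ℕ) ×
      (TaggedTuple ℕ × TaggedTuple ℕ × TaggedTuple ℕ)) × List ℕ) × List ℕ)
    have ht : Primrec fun z : γ => z.1.1.2 := snd.comp (fst.comp fst)
    have hl : Primrec fun z : γ => z.1.1.1 := fst.comp (fst.comp fst)
    have hp' : Primrec fun z : γ => z.1.1.1.1 := fst.comp hl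
    have hp : Primrec fun z : γ => z.1.1.1.1.1 := fst.comp hp'
    have hc : Primrec fun z : γ => z.1.1.1.1.1.1 := fst.comp hp
    have h1 : Primrec fun z : γ => ((z.1.1.2.1.1, z.1.2) : TaggedTuple ℕ) :=
      (fst.comp (fst.comp ht)).pair (snd.comp fst)
    have h2 : Primrec fun z : γ => ((z.1.1.2.2.1.1, z.2) : TaggedTuple ℕ) :=
      (fst.comp (fst.comp (snd.comp ht))).pair snd
    refine PrimrecPred.and ?_ (PrimrecPred.and ?_ (PrimrecPred.and ?_ ?_))
    · exact TaggedTuple.primrecPred_sameOrbit (fst.comp ht) h1 (fst.comp (snd.comp ht)) h2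
    · exact SetCode.primrecPred_rel (primrec_states.comp hc) h1 (fst.comp (snd.comp hp))
    · exact SetCode.primrecPred_rel (primrec_alphabet.comp hc) h2
        ((fst.comp (fst.comp (snd.comp hp'))).pair (snd.comp hl))
    · exact SetCode.primrecPred_rel (primrec_states.comp hc) (snd.comp (snd.comp ht))
        (snd.comp (snd.comp ht))
  have hK : Primrec fun z : (AutomatonCode × (TaggedTuple ℕ × TaggedTuple ℕ)) ×
      (TaggedTuple ℕ × TaggedTuple ℕ) =>
      Encodable.encode z.1.2.1 + Encodable.encode z.2.1 + 1 :=
    succ.comp (nat_add.comp (Primrec.encode.comp (fst.comp (snd.comp fst)))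
      (Primrec.encode.comp (fst.comp snd)))
  have hM : Primrec fun z : (((AutomatonCode × (TaggedTuple ℕ × TaggedTuple ℕ)) ×
      (TaggedTuple ℕ × TaggedTuple ℕ)) × List ℕ) ×
      (TaggedTuple ℕ × TaggedTuple ℕ × TaggedTuple ℕ) =>
      Encodable.encode z.1.1.1.2.1 + Encodable.encode z.1.1.2.1 + 1 +
        (Encodable.encode z.2.1 + Encodable.encode z.2.2.1) :=
    nat_add.comp (hK.comp (fst.comp fst))
      (nat_add.comp (Primrec.encode.comp (fst.comp snd))
        (Primrec.encode.comp (fst.comp (snd.comp snd))))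
  refine PrimrecPred.forall_mem primrec_states
    (PrimrecPred.forall_mem (primrec_alphabet.comp fst)
      (PrimrecPred.forall_mem (primrec_boundedLists.comp hK)
        (PrimrecPred.imp ?_
          (PrimrecPred.exists_mem (primrec_trans.comp (fst.comp (fst.comp fst)))
            (PrimrecPred.exists_mem (primrec_boundedLists.comp hM)
              (PrimrecPred.exists_mem (primrec_boundedLists.comp (hM.comp fst)) key))))))
  have h : Primrec fun z : ((AutomatonCode × (TaggedTuple ℕ × TaggedTuple ℕ)) ×
      (TaggedTuple ℕ × TaggedTuple ℕ)) × List ℕ => z.1.2.1 := fst.comp (snd.comp fst)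
  exact TaggedTuple.primrecPred_sameOrbit h ((fst.comp h).pair snd) h ((fst.comp h).pair snd)

end AutomatonCode

/-! ### Correctness of the decision procedure -/

namespace TaggedTuple

variable {𝔸 : Type u}

theorem map_symm_map (e : ℕ ≃ 𝔸) (x : TaggedTuple 𝔸) : (x.map e.symm).map e = x := by
  rw [map_map, e.self_comp_symm, map_id]

theorem map_map_symm (e : ℕ ≃ 𝔸) (x : TaggedTuple ℕ) : (x.map e).map e.symm = x := by
  rw [map_map, e.symm_comp_self, map_id]

end TaggedTuple

namespace SetCode

variable {s : SetCode} {𝔸 : Type u}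

theorem rel_of_mem {p : TaggedTuple ℕ × TaggedTuple ℕ} (hp : p ∈ s) : s.Rel ℕ p.1 p.2 :=
  ⟨p, hp, Equiv.refl ℕ, p.1.map_id, p.2.map_id⟩

/-- This lets the algorithm work on `ℕ` alone, whatever the atoms are. -/
theorem rel_map_iff (e : ℕ ≃ 𝔸) {x y : TaggedTuple ℕ} :
    s.Rel 𝔸 (x.map e) (y.map e) ↔ s.Rel ℕ x y := by
  constructor
  · rintro ⟨p, hp, e', hx, hy⟩
    refine ⟨p, hp, e'.trans e.symm, ?_, ?_⟩
    · rw [Equiv.coe_trans, ← TaggedTuple.map_map, hx, TaggedTuple.map_map_symm]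
    · rw [Equiv.coe_trans, ← TaggedTuple.map_map, hy, TaggedTuple.map_map_symm]
  · rintro ⟨p, hp, π, rfl, rfl⟩
    exact ⟨p, hp, π.trans e, by rw [Equiv.coe_trans, TaggedTuple.map_map],
      by rw [Equiv.coe_trans, TaggedTuple.map_map]⟩

namespace Presentation

variable {X : Type v} [MulAction (Equiv.Perm 𝔸) X] (P : s.Presentation 𝔸 X)

include P

theorem rel_nat_iff (e : ℕ ≃ 𝔸) {x y : TaggedTuple ℕ} :
    s.Rel ℕ x y ↔ ∃ a, P.el (x.map e) = some a ∧ P.el (y.map e) = some a := by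
  rw [← rel_map_iff e, P.rel_iff]

theorem el_eq_of_rel (e : ℕ ≃ 𝔸) {x y : TaggedTuple ℕ} (h : s.Rel ℕ x y) :
    P.el (x.map e) = P.el (y.map e) := by
  obtain ⟨a, ha, hb⟩ := (P.rel_nat_iff e).1 h
  rw [ha, hb]

theorem exists_el_of_mem (e : ℕ ≃ 𝔸) {p : TaggedTuple ℕ × TaggedTuple ℕ} (hp : p ∈ s) :
    ∃ a, P.el (p.1.map e) = some a := by
  obtain ⟨a, ha, -⟩ := (P.rel_nat_iff e).1 (rel_of_mem hp)
  exact ⟨a, ha⟩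

/-- Every element is presented by the left component of a representative. -/
theorem exists_mem_el_eq (a : X) : ∃ p ∈ s, ∃ e : ℕ ≃ 𝔸, P.el (p.1.map e) = some a := by
  obtain ⟨x, hx⟩ := P.surjective a
  obtain ⟨p, hp, e, rfl, -⟩ := (P.rel_iff x x).2 ⟨a, hx, hx⟩
  exact ⟨p, hp, e, hx⟩

end Presentation

end SetCode

namespace AutomatonCode

open TaggedTuple

variable {c : AutomatonCode} {𝔸 : Type u} {α : Type v} {σ : Type w}
  [MulAction (Equiv.Perm 𝔸) α] [MulAction (Equiv.Perm 𝔸) σ]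

/-- Being related to itself means that a tuple denotes an element, under every enumeration; ignored
tuples fail this. -/
theorem hasStart_iff (s : c.states.Presentation 𝔸 σ) (e₀ : ℕ ≃ 𝔸) {S : Set σ}
    (hS : ∀ q, q ∈ S ↔ ∃ t ∈ c.start, ∃ e : ℕ ≃ 𝔸, s.el (t.map e) = some q) :
    c.HasStart ↔ S.Nonempty := by
  constructor
  · rintro ⟨t, ht, h⟩
    obtain ⟨q, hq, -⟩ := (s.rel_nat_iff e₀).1 h
    exact ⟨q, (hS q).2 ⟨t, ht, e₀, hq⟩⟩
  · rintro ⟨q, hq⟩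
    obtain ⟨t, ht, e, he⟩ := (hS q).1 hq
    exact ⟨t, ht, (s.rel_nat_iff e).2 ⟨q, he, he⟩⟩

/-- The two components of a pair `r` denote the same state, so `r` links the orbit of `t` to that of
`p.1`. Two independent permutations suffice, since only orbits matter; doubled arguments of
`SameOrbit` compare single tuples. -/
theorem allAccept_iff (s : c.states.Presentation 𝔸 σ) (e₀ : ℕ ≃ 𝔸) {S : Set σ}
    (hS : ∀ q, q ∈ S ↔ ∃ t ∈ c.accept, ∃ e : ℕ ≃ 𝔸, s.el (t.map e) = some q) :
    c.AllAccept ↔ ∀ q, q ∈ S := by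
  constructor
  · intro h q
    obtain ⟨p, hp, e, rfl'⟩ := s.exists_mem_el_eq q
    obtain ⟨t, ht, r, hr, h1, h2⟩ := h p hp
    obtain ⟨π, hπ, -⟩ := sameOrbit_iff.1 h1
    obtain ⟨ρ, hρ, -⟩ := sameOrbit_iff.1 h2
    -- The path is from `t` back to `r.1`, across the relation to `r.2`, then by `ρ` to `p.1` and by
    -- `e` to `q`.
    refine (hS q).2 ⟨t, ht, π.symm.trans (ρ.trans e), ?_⟩
    rw [← rfl', ← hπ, ← hρ, map_map, map_map]
    have : (π.symm.trans (ρ.trans e)) ∘ π = ρ.trans e := by ext; simp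
    rw [this]
    exact s.el_eq_of_rel (ρ.trans e) (SetCode.rel_of_mem hr)
  · intro h p hp
    obtain ⟨q, hq⟩ := s.exists_el_of_mem e₀ hp
    obtain ⟨t, ht, e, he⟩ := (hS q).1 (h q)
    have hrel : c.states.Rel ℕ (t.map (e.trans e₀.symm)) p.1 := by
      refine (s.rel_nat_iff e₀).2 ⟨q, ?_, hq⟩
      rwa [Equiv.coe_trans, ← map_map, map_symm_map]
    obtain ⟨r, hr, π, h1, h2⟩ := hrel
    refine ⟨t, ht, r, hr, sameOrbit_iff.2 ⟨π.trans (e.trans e₀.symm).symm, ?_⟩,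
      sameOrbit_iff.2 ⟨π, h2, h2⟩⟩
    rw [Equiv.coe_trans, ← map_map, h1, map_map, Equiv.symm_comp_self, map_id]
    exact ⟨rfl, rfl⟩

theorem allStep_iff (l : c.alphabet.Presentation 𝔸 α) (s : c.states.Presentation 𝔸 σ)
    (e₀ : ℕ ≃ 𝔸) {δ : σ → α → Set σ}
    (hδ : ∀ q a q', q' ∈ δ q a ↔ ∃ t ∈ c.trans, ∃ e : ℕ ≃ 𝔸,
      s.el (t.1.map e) = some q ∧ l.el (t.2.1.map e) = some a ∧ s.el (t.2.2.map e) = some q') :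
    c.AllStep ↔ ∀ q a, (δ q a).Nonempty := by
  constructor
  · intro h q a
    obtain ⟨p, hp, e, hq⟩ := s.exists_mem_el_eq q
    obtain ⟨p', hp', e', ha⟩ := l.exists_mem_el_eq a
    -- The letter is read in the enumeration `e` of the state, then compressed without moving the
    -- entries of `p.1`. This preserves the joint orbit of state and letter.
    obtain ⟨π, hfix, hlt⟩ := List.exists_perm_lt (Encodable.encode p.1 + 1)
      (p'.1.map (e'.trans e.symm)).2
    have hπp : p.1.map π = p.1 :=
      map_eq_self fun b hb => hfix b (Nat.lt_succ_of_le (le_encode_of_mem hb))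
    obtain ⟨t, ht, l₁, -, l₂, -, hor, h1, h2, h3⟩ := h p hp p' hp'
      ((p'.1.map (e'.trans e.symm)).map π).2 (mem_boundedLists.2 (by
        have := p'.1.length_le_encode
        refine ⟨by simp; omega, fun b hb => ?_⟩
        obtain ⟨d, hd, rfl⟩ := List.mem_map.1 hb
        have := hlt d hd
        simp only [map_snd, List.length_map] at this
        omega)) (sameOrbit_iff.2 ⟨(e'.trans e.symm).trans π, by
          simp [TaggedTuple.map]⟩)
    obtain ⟨ρ, hρ1, hρ2⟩ := sameOrbit_iff.1 hor
    have hy : ((p'.1.1, ((p'.1.map (e'.trans e.symm)).map π).2) : TaggedTuple ℕ) =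
      (p'.1.map (e'.trans e.symm)).map π := rfl
    rw [hy] at h2
    obtain ⟨q', hq', -⟩ := (s.rel_nat_iff ((ρ.trans π.symm).trans e)).1 h3
    have hcomp (x : TaggedTuple ℕ) :
        x.map ((ρ.trans π.symm).trans e) = (x.map ρ).map (π.symm.trans e) := by
      rw [map_map]; rfl
    refine ⟨q', (hδ q a q').2 ⟨t, ht, (ρ.trans π.symm).trans e, ?_, ?_, hq'⟩⟩
    · rw [hcomp, hρ1, s.el_eq_of_rel _ h1, ← hq]
      -- As `π` fixes `p.1`, it can be inserted to cancel `π.symm`.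
      nth_rewrite 1 [← hπp]
      rw [map_map]
      congr 2
      ext b
      simp
    · rw [hcomp, hρ2, l.el_eq_of_rel _ h2, ← ha, map_map, map_map]
      congr 2
      ext b
      simp
  · intro h p hp p' hp' m hm hor
    obtain ⟨π, hπ, -⟩ := sameOrbit_iff.1 hor
    obtain ⟨q, hq⟩ := s.exists_el_of_mem e₀ hp
    obtain ⟨a, ha⟩ := l.exists_el_of_mem (π.trans e₀) hp'
    rw [Equiv.coe_trans, ← map_map, hπ] at ha
    obtain ⟨q', hq'⟩ := h q a
    obtain ⟨t, ht, e, h1, h2, h3⟩ := (hδ q a q').1 hq'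
    have hm' := (mem_boundedLists.1 hm).2
    -- Source and letter of the transition are compressed together, with the given state and letter
    -- kept fixed. The target needs no bound: only its membership in the domain is tested, and that
    -- is invariant under permutations.
    obtain ⟨ρ, hfix, hlt⟩ := List.exists_perm_lt
      (Encodable.encode p.1 + Encodable.encode p'.1 + 1)
      (((t.1.map e).map e₀.symm).2 ++ ((t.2.1.map e).map e₀.symm).2)
    have hρp : p.1.map ρ = p.1 := map_eq_self fun b hb => hfix b (by
      have := le_encode_of_mem hb
      omega)
    have hρm : TaggedTuple.map ρ (p'.1.1, m) = (p'.1.1, m) :=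
      map_eq_self fun b hb => hfix b (hm' b hb)
    have hcomp (x : TaggedTuple ℕ) :
        ((x.map e).map e₀.symm).map ρ = x.map ((e.trans e₀.symm).trans ρ) := by
      rw [map_map, map_map]; rfl
    have hlen1 := t.1.length_le_encode
    have hlen2 := t.2.1.length_le_encode
    refine ⟨t, ht, (((t.1.map e).map e₀.symm).map ρ).2, mem_boundedLists.2 ⟨?_, ?_⟩,
      (((t.2.1.map e).map e₀.symm).map ρ).2, mem_boundedLists.2 ⟨?_, ?_⟩,
      sameOrbit_iff.2 ⟨(e.trans e₀.symm).trans ρ, ?_, ?_⟩, ?_, ?_, ?_⟩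
    · simp; omega
    · intro b hb
      obtain ⟨d, hd, rfl⟩ := List.mem_map.1 hb
      have := hlt d (List.mem_append_left _ hd)
      simp only [map_snd, List.length_append, List.length_map] at this
      omega
    · simp; omega
    · intro b hb
      obtain ⟨d, hd, rfl⟩ := List.mem_map.1 hb
      have := hlt d (List.mem_append_right _ hd)
      simp only [map_snd, List.length_append, List.length_map] at this
      omega
    · exact (hcomp _).symm
    · exact (hcomp _).symm
    · have : c.states.Rel ℕ ((t.1.map e).map e₀.symm) p.1 :=
        (s.rel_nat_iff e₀).2 ⟨q, by rwa [map_symm_map], hq⟩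
      have := (SetCode.rel_map_iff ρ).2 this
      rwa [hρp] at this
    · have : c.alphabet.Rel ℕ ((t.2.1.map e).map e₀.symm) (p'.1.1, m) :=
        (l.rel_nat_iff e₀).2 ⟨a, by rwa [map_symm_map], ha⟩
      have := (SetCode.rel_map_iff ρ).2 this
      rwa [hρm] at this
    · exact (s.rel_nat_iff e).2 ⟨q', h3, h3⟩

end AutomatonCode

namespace NominalAutomaton

variable {𝔸 : Type u} {α : Type v} {σ : Type w}
  [MulAction (Equiv.Perm 𝔸) α] [MulAction (Equiv.Perm 𝔸) σ] (A : NominalAutomaton 𝔸 α σ)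

theorem evalFrom_nonempty (h : ∀ q a, (A.step q a).Nonempty) (w : List α) {S : Set σ}
    (hS : S.Nonempty) : (A.evalFrom S w).Nonempty := by
  induction w generalizing S with
  | nil => exact hS
  | cons a w ih =>
    obtain ⟨q, hq⟩ := hS
    obtain ⟨q', hq'⟩ := h q a
    rw [NFA.evalFrom_cons]
    exact ih ⟨q', NFA.mem_stepSet.2 ⟨q, hq, hq'⟩⟩

variable {A}

/-- A derivative of the full language is full, so each state accepts the empty word and every
one-letter word. -/
theorem IsResidual.isUniversal_iff (hA : A.IsResidual) :
    A.IsUniversal ↔ A.start.Nonempty ∧ (∀ q, q ∈ A.accept) ∧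
      ∀ q a, (A.step q a).Nonempty := by
  constructor
  · intro hU
    have hq (q : σ) (u : List α) : u ∈ A.acceptsFrom {q} := by
      obtain ⟨w, hw⟩ := hA q
      rw [hw]
      exact hU (w ++ u)
    refine ⟨?_, fun q => ?_, fun q a => ?_⟩
    · obtain ⟨q, hq, -⟩ := A.nil_mem_acceptsFrom.1 (hU [])
      exact ⟨q, hq⟩
    · simpa using A.nil_mem_acceptsFrom.1 (hq q [])
    · obtain ⟨q', -, hq'⟩ := hq q [a]
      rw [NFA.evalFrom_singleton, NFA.stepSet_singleton] at hq'
      exact ⟨q', hq'⟩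
  · rintro ⟨h1, h2, h3⟩ w
    obtain ⟨q, hq⟩ := A.evalFrom_nonempty h3 w h1
    exact ⟨q, h2 q, hq⟩

end NominalAutomaton

/-! ### Existence of representations -/

section Existence

variable {𝔸 : Type u}

/-- Finitely many atoms can be named by small numbers; this makes the lists of representatives
finite. -/
theorem exists_equiv_symm_lt (e₀ : ℕ ≃ 𝔸) (L : List 𝔸) :
    ∃ e : ℕ ≃ 𝔸, ∀ a ∈ L, e.symm a < L.length := by
  obtain ⟨π, -, hπ⟩ := List.exists_perm_lt 0 (L.map e₀.symm)
  refine ⟨π.symm.trans e₀, fun a ha => ?_⟩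
  simpa using hπ (e₀.symm a) (List.mem_map_of_mem ha)

/-- The tagged tuples with tag and entries below `K` and length at most `K`. -/
def boundedTuples (K : ℕ) : List (TaggedTuple ℕ) := List.range K ×ˢ boundedLists K

theorem mem_boundedTuples {K : ℕ} {t : TaggedTuple ℕ} :
    t ∈ boundedTuples K ↔ t.1 < K ∧ t.2.length ≤ K ∧ ∀ a ∈ t.2, a < K := by
  rw [boundedTuples, ← Prod.mk.eta (p := t), List.mem_product, List.mem_range, mem_boundedLists]

theorem map_symm_mem_boundedTuples {K N : ℕ} (hKN : K ≤ N) {e : ℕ ≃ 𝔸} {x : TaggedTuple 𝔸}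
    (hx : x.1 < K ∧ x.2.length ≤ K) (he : ∀ a ∈ x.2, e.symm a < N) :
    x.map e.symm ∈ boundedTuples N := by
  refine mem_boundedTuples.2 ⟨hx.1.trans_le hKN, by simpa using hx.2.trans hKN, fun a ha => ?_⟩
  obtain ⟨b, hb, rfl⟩ := List.mem_map.1 ha
  exact he b hb

namespace SetCode.Presentation

variable {s : SetCode} {X : Type v} [MulAction (Equiv.Perm 𝔸) X] (P : s.Presentation 𝔸 X)

/-- Tags and lengths of the tuples in the domain are bounded by `K`. -/
def IsBoundedBy (K : ℕ) : Prop := ∀ x a, P.el x = some a → x.1 < K ∧ x.2.length ≤ K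

theorem el_map_of_el_map {t : TaggedTuple ℕ} {a : X} {e : ℕ ≃ 𝔸} (h : P.el (t.map e) = some a)
    (e' : ℕ ≃ 𝔸) : P.el (t.map e') = some ((e.symm.trans e' : Equiv.Perm 𝔸) • a) := by
  have := P.equivariant (e.symm.trans e') (t.map e)
  rw [h, TaggedTuple.map_map, Equiv.coe_trans, Function.comp_assoc, Equiv.symm_comp_self,
    Function.comp_id] at this
  exact this

end SetCode.Presentation

/-- The tag names the orbit and the tuple is the moved support of its representative. Permutations
that agree on a support move the representative to the same point, so the tuple determines the
element. -/
theorem exists_isBoundedBy_presentation (e₀ : ℕ ≃ 𝔸) {X : Type v}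
    [MulAction (Equiv.Perm 𝔸) X] (hX : IsNominal 𝔸 X) (hfin : IsOrbitFinite 𝔸 X) :
    ∃ (s : SetCode) (P : s.Presentation 𝔸 X) (K : ℕ), P.IsBoundedBy K := by
  classical
  let Ω := MulAction.orbitRel.Quotient (Equiv.Perm 𝔸) X
  have : Finite Ω := hfin
  obtain ⟨n, ⟨ι⟩⟩ := Finite.exists_equiv_fin Ω
  choose S hS using hX
  let rep : Ω → X := Quotient.out
  let supp : Ω → List 𝔸 := fun ω => (S (rep ω)).toList
  let R : TaggedTuple 𝔸 → X → Prop := fun x a =>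
    ∃ (ω : Ω) (π : Equiv.Perm 𝔸), x = ((ι ω : ℕ), (supp ω).map π) ∧ a = π • rep ω
  have hR : ∀ {x a b}, R x a → R x b → a = b := by
    rintro x a b ⟨ω, π, rfl, rfl⟩ ⟨ω', π', h, rfl⟩
    obtain ⟨h1, h2⟩ := Prod.ext_iff.1 h
    obtain rfl : ω = ω' := ι.injective (Fin.ext h1)
    -- `π` and `π'` agree on the support, so `π'⁻¹ * π` fixes it pointwise.
    have h3 : (π'⁻¹ * π) • rep ω = rep ω := hS (rep ω) _ fun a ha => by
      have := List.map_inj_left.1 h2 a (by simpa [supp] using ha)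
      rw [mul_smul, inv_smul_eq_iff]
      exact this
    rw [mul_smul, inv_smul_eq_iff] at h3
    exact h3
  have hRmap : ∀ (π : Equiv.Perm 𝔸) {x a}, R x a → R (x.map π) (π • a) := by
    rintro π x a ⟨ω, ρ, rfl, rfl⟩
    exact ⟨ω, π * ρ, by simp [TaggedTuple.map], by rw [mul_smul]⟩
  let el : TaggedTuple 𝔸 → Option X := fun x => if h : ∃ a, R x a then some h.choose else none
  have hel : ∀ x a, el x = some a ↔ R x a := by
    intro x a
    simp only [el]
    split_ifs with h
    · rw [Option.some_inj]
      exact ⟨fun h' => h' ▸ h.choose_spec, fun h' => hR h.choose_spec h'⟩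
    · simpa using fun h' => h ⟨a, h'⟩
  have hequiv (π : Equiv.Perm 𝔸) (x : TaggedTuple 𝔸) : el (x.map π) = (el x).map (π • ·) := by
    ext a
    rw [Option.map_eq_some_iff, hel]
    constructor
    · intro h
      refine ⟨π⁻¹ • a, (hel _ _).2 ?_, smul_inv_smul π a⟩
      have := hRmap π⁻¹ h
      rwa [TaggedTuple.map_map, ← Equiv.Perm.coe_mul, inv_mul_cancel, Equiv.Perm.coe_one,
        TaggedTuple.map_id] at this
    · rintro ⟨b, hb, rfl⟩
      exact hRmap π ((hel _ _).1 hb)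
  have hsurj (a : X) : ∃ x, el x = some a := by
    obtain ⟨π, hπ⟩ : rep (Quotient.mk _ a) ∈ MulAction.orbit (Equiv.Perm 𝔸) a :=
      MulAction.orbitRel_apply.1 (Quotient.exact (Quotient.out_eq (Quotient.mk _ a)))
    exact ⟨_, (hel _ _).2 ⟨Quotient.mk _ a, π⁻¹, rfl, by rw [← hπ]; simp⟩⟩
  obtain ⟨m, hm⟩ := (Set.finite_range fun ω => (supp ω).length).bddAbove
  have hbound : ∀ x a, el x = some a → x.1 < n + m ∧ x.2.length ≤ n + m := by
    intro x a h
    obtain ⟨ω, π, rfl, -⟩ := (hel x a).1 h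
    have h1 := (ι ω).2
    have h2 : (supp ω).length ≤ m := hm ⟨ω, rfl⟩
    exact ⟨by dsimp only; omega, by simp only [List.length_map]; omega⟩
  let K := n + m
  -- A related pair involves at most `2 * K` atoms.
  let s : SetCode := (boundedTuples (2 * K) ×ˢ boundedTuples (2 * K)).filter
    fun p => ∃ a, el (p.1.map e₀) = some a ∧ el (p.2.map e₀) = some a
  refine ⟨s, ⟨el, hsurj, hequiv, fun x y => ?_⟩, K, hbound⟩
  constructor
  · rintro ⟨p, hp, e, rfl, rfl⟩
    obtain ⟨a, h1, h2⟩ := of_decide_eq_true (List.mem_filter.1 hp).2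
    have hcomp (t : TaggedTuple ℕ) : t.map e = (t.map e₀).map (e₀.symm.trans e) := by
      rw [TaggedTuple.map_map, Equiv.coe_trans, Function.comp_assoc, Equiv.symm_comp_self,
        Function.comp_id]
    refine ⟨(e₀.symm.trans e : Equiv.Perm 𝔸) • a, ?_, ?_⟩
    · rw [hcomp, hequiv, h1]; rfl
    · rw [hcomp, hequiv, h2]; rfl
  · rintro ⟨a, hx, hy⟩
    have hbx := hbound x a hx
    have hby := hbound y a hy
    obtain ⟨e, he⟩ := exists_equiv_symm_lt e₀ (x.2 ++ y.2)
    rw [List.length_append] at he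
    refine ⟨(x.map e.symm, y.map e.symm), List.mem_filter.2 ⟨List.mem_product.2 ⟨?_, ?_⟩,
      decide_eq_true ⟨(e.symm.trans e₀ : Equiv.Perm 𝔸) • a, ?_, ?_⟩⟩, e,
      TaggedTuple.map_symm_map e x, TaggedTuple.map_symm_map e y⟩
    · exact map_symm_mem_boundedTuples (by omega) hbx fun b hb =>
        (he b (List.mem_append_left _ hb)).trans_le (by omega)
    · exact map_symm_mem_boundedTuples (by omega) hby fun b hb =>
        (he b (List.mem_append_right _ hb)).trans_le (by omega)
    · rw [TaggedTuple.map_map, ← Equiv.coe_trans, hequiv, hx]; rfl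
    · rw [TaggedTuple.map_map, ← Equiv.coe_trans, hequiv, hy]; rfl

/-- Changing the enumeration moves the denoted element by a permutation, so testing membership in an
equivariant set under `e₀` alone is enough. -/
theorem SetCode.Presentation.exists_representatives (e₀ : ℕ ≃ 𝔸) {s : SetCode} {X : Type v}
    [MulAction (Equiv.Perm 𝔸) X] (P : s.Presentation 𝔸 X) {K : ℕ} (hK : P.IsBoundedBy K)
    {S : Set X} (hS : ∀ (π : Equiv.Perm 𝔸) (a : X), a ∈ S → π • a ∈ S) :
    ∃ ts : List (TaggedTuple ℕ),
      ∀ a, a ∈ S ↔ ∃ t ∈ ts, ∃ e : ℕ ≃ 𝔸, P.el (t.map e) = some a := by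
  classical
  refine ⟨(boundedTuples K).filter fun t => ∃ a ∈ S, P.el (t.map e₀) = some a, fun a => ?_⟩
  constructor
  · intro ha
    obtain ⟨x, hx⟩ := P.surjective a
    have hbx := hK x a hx
    obtain ⟨e, he⟩ := exists_equiv_symm_lt e₀ x.2
    have hx' : P.el ((x.map e.symm).map e) = some a := by rwa [TaggedTuple.map_symm_map]
    exact ⟨x.map e.symm, List.mem_filter.2 ⟨map_symm_mem_boundedTuples le_rfl hbx fun b hb =>
      (he b hb).trans_le hbx.2, decide_eq_true ⟨_, hS _ a ha, P.el_map_of_el_map hx' e₀⟩⟩, e, hx'⟩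
  · rintro ⟨t, ht, e, he⟩
    obtain ⟨b, hb, hb'⟩ := of_decide_eq_true (List.mem_filter.1 ht).2
    obtain rfl := Option.some_inj.1 (he.symm.trans (P.el_map_of_el_map hb' e))
    exact hS _ b hb

theorem NominalAutomaton.exists_represents (e₀ : ℕ ≃ 𝔸) {α : Type v} {σ : Type w}
    [MulAction (Equiv.Perm 𝔸) α] [MulAction (Equiv.Perm 𝔸) σ] (A : NominalAutomaton 𝔸 α σ) :
    ∃ c : AutomatonCode, c.Represents A := by
  classical
  obtain ⟨cl, l, K₁, hl⟩ :=
    exists_isBoundedBy_presentation e₀ A.nominal_alphabet A.orbitFinite_alphabet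
  obtain ⟨cs, s, K₂, hs⟩ :=
    exists_isBoundedBy_presentation e₀ A.nominal_states A.orbitFinite_states
  obtain ⟨starts, hstart⟩ := s.exists_representatives e₀ hs A.start_equivariant
  obtain ⟨accepts, haccept⟩ := s.exists_representatives e₀ hs A.accept_equivariant
  -- A transition involves one letter and two states, hence at most this many atoms.
  let N := K₁ + 2 * K₂
  let B := boundedTuples N
  let trans : List (TaggedTuple ℕ × TaggedTuple ℕ × TaggedTuple ℕ) := (B ×ˢ (B ×ˢ B)).filter
    fun t => ∃ q a q', q' ∈ A.step q a ∧ s.el (t.1.map e₀) = some q ∧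
      l.el (t.2.1.map e₀) = some a ∧ s.el (t.2.2.map e₀) = some q'
  refine ⟨⟨cl, cs, starts, accepts, trans⟩, l, s, hstart, haccept, fun q a q' => ?_⟩
  constructor
  · intro h
    obtain ⟨x, hx⟩ := s.surjective q
    obtain ⟨y, hy⟩ := l.surjective a
    obtain ⟨z, hz⟩ := s.surjective q'
    have hbx := hs x q hx
    have hby := hl y a hy
    have hbz := hs z q' hz
    obtain ⟨e, he⟩ := exists_equiv_symm_lt e₀ (x.2 ++ (y.2 ++ z.2))
    have hlen : (x.2 ++ (y.2 ++ z.2)).length ≤ N := by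
      simp only [List.length_append, N]
      omega
    have hx' : s.el ((x.map e.symm).map e) = some q := by rwa [TaggedTuple.map_symm_map]
    have hy' : l.el ((y.map e.symm).map e) = some a := by rwa [TaggedTuple.map_symm_map]
    have hz' : s.el ((z.map e.symm).map e) = some q' := by rwa [TaggedTuple.map_symm_map]
    refine ⟨(x.map e.symm, y.map e.symm, z.map e.symm), List.mem_filter.2
      ⟨List.mem_product.2 ⟨?_, List.mem_product.2 ⟨?_, ?_⟩⟩, decide_eq_true
        ⟨_, _, _, A.step_equivariant _ q a q' h, s.el_map_of_el_map hx' e₀,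
          l.el_map_of_el_map hy' e₀, s.el_map_of_el_map hz' e₀⟩⟩, e, hx', hy', hz'⟩
    · exact map_symm_mem_boundedTuples (by omega) hbx fun b hb =>
        (he b (by simp [hb])).trans_le hlen
    · exact map_symm_mem_boundedTuples (by omega) hby fun b hb =>
        (he b (by simp [hb])).trans_le hlen
    · exact map_symm_mem_boundedTuples (by omega) hbz fun b hb =>
        (he b (by simp [hb])).trans_le hlen
  · rintro ⟨t, ht, e, h1, h2, h3⟩
    obtain ⟨r, b, r', hstep, hr, hb, hr'⟩ := of_decide_eq_true (List.mem_filter.1 ht).2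
    obtain rfl := Option.some_inj.1 (h1.symm.trans (s.el_map_of_el_map hr e))
    obtain rfl := Option.some_inj.1 (h2.symm.trans (l.el_map_of_el_map hb e))
    obtain rfl := Option.some_inj.1 (h3.symm.trans (s.el_map_of_el_map hr' e))
    exact A.step_equivariant _ r b r' hstep

end Existence

/-- The first part says that every nominal automaton over countably infinitely many atoms has a
finite representation; the second part gives one algorithm on finite representations. -/
theorem proposition5p1 :
    (∀ (𝔸 : Type u) [Countable 𝔸] [Infinite 𝔸] (α : Type v) (σ : Type w)
      [MulAction (Equiv.Perm 𝔸) α] [MulAction (Equiv.Perm 𝔸) σ] (A : NominalAutomaton 𝔸 α σ),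
      ∃ c : AutomatonCode, c.Represents A) ∧
    ∃ decideUniversal : AutomatonCode → Bool, Computable decideUniversal ∧
      ∀ (𝔸 : Type u) [Countable 𝔸] [Infinite 𝔸] (α : Type v) (σ : Type w)
        [MulAction (Equiv.Perm 𝔸) α] [MulAction (Equiv.Perm 𝔸) σ] (A : NominalAutomaton 𝔸 α σ)
        (c : AutomatonCode), c.Represents A →
        (decideUniversal c = true ↔
          A.start.Nonempty ∧ (∀ q : σ, q ∈ A.accept) ∧
            ∀ (q : σ) (a : α), (A.step q a).Nonempty) ∧
        (A.IsResidual → (decideUniversal c = true ↔ A.IsUniversal)) := by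
  refine ⟨fun 𝔸 _ _ α σ _ _ A => ?_, ?_⟩
  · obtain ⟨e₀⟩ : Nonempty (ℕ ≃ 𝔸) := nonempty_equiv_of_countable
    exact A.exists_represents e₀
  obtain ⟨hdec, hprim⟩ := AutomatonCode.primrecPred_hasStart.and
    (AutomatonCode.primrecPred_allAccept.and AutomatonCode.primrecPred_allStep)
  refine ⟨_, hprim.to_comp, fun 𝔸 _ _ α σ _ _ A c hc => ?_⟩
  obtain ⟨e₀⟩ : Nonempty (ℕ ≃ 𝔸) := nonempty_equiv_of_countable
  obtain ⟨l, s, hstart, haccept, htrans⟩ := hc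
  have h : decide (c.HasStart ∧ c.AllAccept ∧ c.AllStep) = true ↔
      A.start.Nonempty ∧ (∀ q : σ, q ∈ A.accept) ∧ ∀ (q : σ) (a : α), (A.step q a).Nonempty := by
    rw [decide_eq_true_iff, AutomatonCode.hasStart_iff s e₀ hstart,
      AutomatonCode.allAccept_iff s e₀ haccept, AutomatonCode.allStep_iff l s e₀ htrans]
  exact ⟨h, fun hA => h.trans hA.isUniversal_iff.symm⟩
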